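/- Let $$C(x,y,q)=\frac{x(1-q^2x^2y)}{(1+xq)(1+xyq)},\qquad \mathcal P_{\mathrm{tree}}(x,y,q)=x\bigl(1+y+yq\,C^{\langle -1\rangle}(x,y,q)\bigr),$$ regarded as formal power series in $x$ whose coefficients are polynomials in $y$ and $q$ with integer coefficients. Here $F^{\langle -1\rangle}$ denotes the compositional inverse of $F$ with respect to $x$, i.e. the power series $G$ in $x$ without constant term such that $F(G(x))=G(F(x))=x$. A permutation is *separable* if it avoids the patterns $2413$ and $3142$; a *descent* of a permutation $w$ of $\{1,\dots,N\}$ is an index $1\le i<N$ with $w(i)>w(i+1)$. Let $n\ge 1$ and $k\ge 0$ be integers with $(n,k)\ne(1,0)$. Then the number of separable permutations of $n-1$ letters with exactly $k-1$ descents (there are none if $k=0$; for $n=1$ the empty permutation counts as one separable permutation with $0$ descents) is $$[x^ny^k]\,\mathcal P_{\mathrm{tree}}(x,y,1)=[x^ny^k]\left(x+xy+xy\left(\frac{x(1-x^2y)}{(1+x)(1+xy)}\right)^{\langle -1\rangle}\right).$$ -/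

import Mathlib

noncomputable section

/-- `σ` contains the pattern `p` (one-line notation): some subsequence
`σ (f 0), …, σ (f (m - 1))` with `f 0 < ⋯ < f (m - 1)` is ordered in the same way as
`p 0, …, p (m - 1)`. -/
def ContainsPattern {m N : ℕ} (σ : Equiv.Perm (Fin N)) (p : Fin m → ℕ) : Prop :=
  ∃ f : Fin m ↪o Fin N, ∀ i j : Fin m, σ (f i) < σ (f j) ↔ p i < p j

/-- A permutation is separable if it avoids the patterns `2413` and `3142`. -/
def IsSeparablePerm {N : ℕ} (σ : Equiv.Perm (Fin N)) : Prop :=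
  ¬ ContainsPattern σ ![2, 4, 1, 3] ∧ ¬ ContainsPattern σ ![3, 1, 4, 2]

/-- The number of descents: positions `i` such that `i + 1` is again a position and
`σ i > σ (i + 1)`. -/
def descentCount {N : ℕ} (σ : Equiv.Perm (Fin N)) : ℕ :=
  Nat.card {i : Fin N // ∃ h : (i : ℕ) + 1 < N, σ ⟨(i : ℕ) + 1, h⟩ < σ i}

section Series

variable {R : Type*} [CommRing R]

/-- The series `x (1 - q² x² y) / ((1 + x q) (1 + x y q))` in the variable `x`, for parameters
`y`, `q` in the coefficient ring. The denominator has constant coefficient `1`. -/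
def cSeries (y q : R) : PowerSeries R :=
  PowerSeries.X * (1 - PowerSeries.C (q ^ 2) * PowerSeries.X ^ 2 * PowerSeries.C y) *
    PowerSeries.invOfUnit
      ((1 + PowerSeries.X * PowerSeries.C q) *
        (1 + PowerSeries.X * PowerSeries.C y * PowerSeries.C q)) 1

/-- The defining property of the fraction `cSeries y q`. -/
theorem cSeries_mul_denominator (y q : R) :
    cSeries y q * ((1 + PowerSeries.X * PowerSeries.C q) *
        (1 + PowerSeries.X * PowerSeries.C y * PowerSeries.C q)) =
      PowerSeries.X * (1 - PowerSeries.C (q ^ 2) * PowerSeries.X ^ 2 * PowerSeries.C y) := by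
  rw [cSeries, mul_assoc, PowerSeries.invOfUnit_mul _ _ (by simp), mul_one]

theorem constantCoeff_cSeries (y q : R) : PowerSeries.constantCoeff (cSeries y q) = 0 := by
  simp [cSeries]

theorem isUnit_coeff_one_cSeries (y q : R) : IsUnit (PowerSeries.coeff 1 (cSeries y q)) := by
  have h : PowerSeries.coeff 1 (cSeries y q) = 1 := by
    rw [cSeries, mul_assoc, show (1 : ℕ) = 0 + 1 from rfl, PowerSeries.coeff_succ_X_mul]
    simp
  rw [h]
  exact isUnit_one

/-- The compositional inverse of `cSeries y q` with respect to `x`. -/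
def cSeriesInv (y q : R) : PowerSeries R :=
  PowerSeries.substInvOfIsUnit (cSeries y q) (isUnit_coeff_one_cSeries y q)

/-- `cSeriesInv y q` is the two-sided inverse of `cSeries y q` for substitution. -/
theorem cSeriesInv_spec (y q : R) :
    PowerSeries.subst (cSeriesInv y q) (cSeries y q) = PowerSeries.X ∧
      PowerSeries.subst (cSeries y q) (cSeriesInv y q) = PowerSeries.X :=
  ⟨PowerSeries.subst_substInvOfIsUnit_right _ (constantCoeff_cSeries y q) _,
    PowerSeries.subst_substInvOfIsUnit_left _ (constantCoeff_cSeries y q) _⟩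

end Series

/-- `P_tree(x, y, q) = x (1 + y + y q C⁻¹(x, y, q))`, where `C = cSeries`, as a power series in `x`
whose coefficients are polynomials in `q` over `ℤ[y]`; here `y` is `Polynomial.C Polynomial.X`
and `q` is `Polynomial.X`. -/
def pTree : PowerSeries (Polynomial (Polynomial ℤ)) :=
  PowerSeries.X *
    (1 + PowerSeries.C (Polynomial.C Polynomial.X) +
      PowerSeries.C (Polynomial.C Polynomial.X) * PowerSeries.C Polynomial.X *
        cSeriesInv (Polynomial.C Polynomial.X : Polynomial (Polynomial ℤ)) Polynomial.X)

/-- The specialization `P_tree(x, y, q = 1)`, a power series in `x` over `ℤ[y]`. -/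
def pTreeAtOne : PowerSeries (Polynomial ℤ) :=
  PowerSeries.map (Polynomial.evalRingHom (1 : Polynomial ℤ)) pTree

/-- The series `x (1 - x² y) / ((1 + x) (1 + x y))` in `x` over `ℤ[y]`. -/
def sepC : PowerSeries (Polynomial ℤ) :=
  PowerSeries.X * (1 - PowerSeries.X ^ 2 * PowerSeries.C Polynomial.X) *
    PowerSeries.invOfUnit
      ((1 + PowerSeries.X) * (1 + PowerSeries.X * PowerSeries.C Polynomial.X)) 1

theorem constantCoeff_sepC : PowerSeries.constantCoeff sepC = 0 := by
  simp [sepC]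

theorem isUnit_coeff_one_sepC : IsUnit (PowerSeries.coeff 1 sepC) := by
  have h : PowerSeries.coeff 1 sepC = 1 := by
    rw [sepC, mul_assoc, show (1 : ℕ) = 0 + 1 from rfl, PowerSeries.coeff_succ_X_mul]
    simp
  rw [h]
  exact isUnit_one

/-- The compositional inverse of `sepC` with respect to `x`. -/
def sepCInv : PowerSeries (Polynomial ℤ) :=
  PowerSeries.substInvOfIsUnit sepC isUnit_coeff_one_sepC

/-- `sepCInv` is the two-sided inverse of `sepC` for substitution. -/
theorem sepCInv_spec :
    PowerSeries.subst sepCInv sepC = PowerSeries.X ∧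
      PowerSeries.subst sepC sepCInv = PowerSeries.X :=
  ⟨PowerSeries.subst_substInvOfIsUnit_right _ constantCoeff_sepC _,
    PowerSeries.subst_substInvOfIsUnit_left _ constantCoeff_sepC _⟩

/-- The coefficient `[x^n y^k]` of a power series in `x` over `ℤ[y]`. -/
def coeffXY (n k : ℕ) (F : PowerSeries (Polynomial ℤ)) : ℤ :=
  (PowerSeries.coeff n F).coeff k

end

/-! A separable permutation of at least two letters is either a direct sum or a skew sum, never both
(`exists_split_of_avoids`, `firstSplit_complPerm_eq_iff`). Let S, A, B be the generating functions,
with y marking descents, of the nonempty separable permutations, of those that are not direct sums,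
and of those that are not skew sums. Splitting off the first component gives S = A(1 + S), and S =
B(1 + yS) for skew sums, whose junction is an extra descent. The dichotomy gives A + B = S + x, the
single letter being counted twice. Eliminating A and B yields S(1 - yS²) = x(1 + S)(1 + yS)
(`sepSeries_functional_equation`), which says that S is the compositional inverse of C at q = 1
(`eq_cSeriesInv`). Then P_tree = x(1 + y(1 + S)), where 1 + S also counts the empty permutation. -/

noncomputable section

/-! ### Pattern avoidance as inequalities -/

/-- The four positions of an occurrence of a pattern of length four. -/
theorem containsPattern_four_iff {N : ℕ} (σ : Equiv.Perm (Fin N)) (p : Fin 4 → ℕ) :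
    ContainsPattern σ p ↔ ∃ a b c d : Fin N, a < b ∧ b < c ∧ c < d ∧
      ∀ i j : Fin 4, σ (![a, b, c, d] i) < σ (![a, b, c, d] j) ↔ p i < p j := by
  constructor
  · rintro ⟨f, hf⟩
    refine ⟨f 0, f 1, f 2, f 3, by simp, by simp, by simp, fun i j => ?_⟩
    have h : ∀ i : Fin 4, ![f 0, f 1, f 2, f 3] i = f i := by
      intro i; fin_cases i <;> rfl
    rw [h, h, hf]
  · rintro ⟨a, b, c, d, hab, hbc, hcd, h⟩
    refine ⟨OrderEmbedding.ofStrictMono ![a, b, c, d] ?_, h⟩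
    rw [Fin.strictMono_iff_lt_succ]
    intro i
    fin_cases i
    · exact hab
    · exact hbc
    · exact hcd

theorem containsPattern_2413_iff {N : ℕ} (σ : Equiv.Perm (Fin N)) :
    ContainsPattern σ ![2, 4, 1, 3] ↔ ∃ a b c d : Fin N, a < b ∧ b < c ∧ c < d ∧
      σ c < σ a ∧ σ a < σ d ∧ σ d < σ b := by
  rw [containsPattern_four_iff]
  refine exists_congr fun a => exists_congr fun b => exists_congr fun c => exists_congr fun d =>
    and_congr_right fun _ => and_congr_right fun _ => and_congr_right fun _ => ?_
  constructor
  · intro h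
    exact ⟨(h 2 0).2 (by decide), (h 0 3).2 (by decide), (h 3 1).2 (by decide)⟩
  · rintro ⟨h1, h2, h3⟩ i j
    fin_cases i <;> fin_cases j <;> simp <;> order

theorem containsPattern_3142_iff {N : ℕ} (σ : Equiv.Perm (Fin N)) :
    ContainsPattern σ ![3, 1, 4, 2] ↔ ∃ a b c d : Fin N, a < b ∧ b < c ∧ c < d ∧
      σ b < σ d ∧ σ d < σ a ∧ σ a < σ c := by
  rw [containsPattern_four_iff]
  refine exists_congr fun a => exists_congr fun b => exists_congr fun c => exists_congr fun d =>
    and_congr_right fun _ => and_congr_right fun _ => and_congr_right fun _ => ?_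
  constructor
  · intro h
    exact ⟨(h 1 3).2 (by decide), (h 3 0).2 (by decide), (h 0 2).2 (by decide)⟩
  · rintro ⟨h1, h2, h3⟩ i j
    fin_cases i <;> fin_cases j <;> simp <;> order

theorem isSeparablePerm_iff {N : ℕ} (σ : Equiv.Perm (Fin N)) :
    IsSeparablePerm σ ↔ ∀ a b c d : Fin N, a < b → b < c → c < d →
      ¬ (σ c < σ a ∧ σ a < σ d ∧ σ d < σ b) ∧ ¬ (σ b < σ d ∧ σ d < σ a ∧ σ a < σ c) := by
  rw [IsSeparablePerm, containsPattern_2413_iff, containsPattern_3142_iff]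
  constructor
  · rintro ⟨h1, h2⟩ a b c d hab hbc hcd
    exact ⟨fun h => h1 ⟨a, b, c, d, hab, hbc, hcd, h⟩,
      fun h => h2 ⟨a, b, c, d, hab, hbc, hcd, h⟩⟩
  · intro h
    exact ⟨fun ⟨a, b, c, d, hab, hbc, hcd, h'⟩ => (h a b c d hab hbc hcd).1 h',
      fun ⟨a, b, c, d, hab, hbc, hcd, h'⟩ => (h a b c d hab hbc hcd).2 h'⟩

/-! ### Avoiding sequences can be cut -/

/-- The inductive step for `exists_split_of_avoids`: an increasing split of a prefix of a sequence
can be adapted to the prefix with one more entry. -/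
theorem exists_split_succ_of_split (f : ℕ → ℤ) (hf : Function.Injective f) (m i : ℕ)
    (h3142 : ∀ a b c d, a < b → b < c → c < d → d ≤ m →
      ¬ (f b < f d ∧ f d < f a ∧ f a < f c))
    (hi : 0 < i) (him : i < m) (hs : ∀ p q, p < i → i ≤ q → q < m → f p < f q) :
    ∃ i, 0 < i ∧ i < m + 1 ∧ ((∀ p q, p < i → i ≤ q → q < m + 1 → f p < f q) ∨
      (∀ p q, p < i → i ≤ q → q < m + 1 → f q < f p)) := by
  induction i using Nat.strong_induction_on with
  | _ i ih =>
  by_cases hlow : ∀ p, p < i → f p < f m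
  · refine ⟨i, hi, by omega, Or.inl fun p q hp hq hqm => ?_⟩
    rcases Nat.lt_succ_iff_lt_or_eq.1 hqm with h | rfl
    · exact hs p q hp hq h
    · exact hlow p hp
  push Not at hlow
  classical
  have hne : ∀ p, p < m → f p ≠ f m := fun p hp h => hp.ne (hf h)
  -- k is the first index of the lower block whose value exceeds the new entry `f m`.
  obtain ⟨hk, hkm⟩ := Nat.find_spec hlow
  have hmin := fun p => Nat.find_min hlow (m := p)
  set k := Nat.find hlow with hkdef
  rcases Nat.eq_zero_or_pos k with h0 | hpos
  -- Either the new entry lies below everything, giving a decreasing cut at m, or some `f b < f m`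
  -- makes k, b, i, m an occurrence of 3142.
  · by_cases hall : ∀ p, p < i → f m < f p
    · refine ⟨m, by omega, by omega, Or.inr fun p q hp hq hqm => ?_⟩
      obtain rfl : q = m := by omega
      by_cases hpi : p < i
      · exact hall p hpi
      · exact (hall 0 hi).trans (hs 0 p hi (by omega) hp)
    · push Not at hall
      obtain ⟨b, hb, hbm⟩ := hall
      have := hne b (by omega)
      have := hne k (by omega)
      have hkb : k ≠ b := by rintro rfl; omega
      exact absurd ⟨by omega, by omega, hs k i hk le_rfl him⟩
        (h3142 k b i m (by omega) hb him le_rfl)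
  -- The old prefix also splits at k < i: an entry q of the lower block after k with `f q < f m`
  -- would make k, q, i, m an occurrence of 3142.
  · refine ih k hk hpos (by omega) fun p q hp hq hqm => ?_
    by_cases hqi : q < i
    · have hpm : f p < f m := by
        have := hmin p hp
        push Not at this
        exact this (by omega)
      refine hpm.trans_le ?_
      by_contra hlt
      have := hne k (by omega)
      have hkq : k ≠ q := by rintro rfl; omega
      exact h3142 k q i m (by omega) hqi him le_rfl
        ⟨by omega, by omega, hs k i hk le_rfl him⟩
    · exact hs p q (by omega) (by omega) hqm

/-- A sequence of at least two distinct numbers which avoids `2413` and `3142` can be cut into two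
nonempty pieces such that one piece lies entirely above the other. -/
theorem exists_split_of_avoids (f : ℕ → ℤ) (hf : Function.Injective f) (m : ℕ) (hm : 2 ≤ m)
    (h : ∀ a b c d, a < b → b < c → c < d → d < m →
      ¬ (f c < f a ∧ f a < f d ∧ f d < f b) ∧ ¬ (f b < f d ∧ f d < f a ∧ f a < f c)) :
    ∃ i, 0 < i ∧ i < m ∧ ((∀ p q, p < i → i ≤ q → q < m → f p < f q) ∨
      (∀ p q, p < i → i ≤ q → q < m → f q < f p)) := by
  induction m, hm using Nat.le_induction with
  | base =>
    refine ⟨1, by omega, by omega, ?_⟩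
    rcases lt_or_gt_of_ne (hf.ne (show 0 ≠ 1 by omega)) with h01 | h01
    · refine Or.inl fun p q hp hq hq2 => ?_
      obtain rfl : p = 0 := by omega
      obtain rfl : q = 1 := by omega
      exact h01
    · refine Or.inr fun p q hp hq hq2 => ?_
      obtain rfl : p = 0 := by omega
      obtain rfl : q = 1 := by omega
      exact h01
  | succ m hm ih =>
    obtain ⟨i, hi, him, hs | hs⟩ :=
      ih fun a b c d hab hbc hcd hd => h a b c d hab hbc hcd (by omega)
    · exact exists_split_succ_of_split f hf m i
        (fun a b c d hab hbc hcd hd => (h a b c d hab hbc hcd (by omega)).2) hi him hs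
    -- Negation turns decreasing cuts into increasing ones and exchanges 2413 with 3142.
    · obtain ⟨k, hk, hkm, h'⟩ := exists_split_succ_of_split (fun n => -f n)
        (fun a b hab => hf (neg_injective hab)) m i
        (fun a b c d hab hbc hcd hd h' => (h a b c d hab hbc hcd (by omega)).1
          ⟨neg_lt_neg_iff.1 h'.2.2, neg_lt_neg_iff.1 h'.2.1, neg_lt_neg_iff.1 h'.1⟩)
        hi him (fun p q hp hq hqm => neg_lt_neg (hs p q hp hq hqm))
      simp only [neg_lt_neg_iff] at h'
      exact ⟨k, hk, hkm, h'.symm⟩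

/-! ### First components and complements -/

/-- The permutation maps the first `i` positions below all the later ones. -/
def IsSplitAt {N : ℕ} (σ : Equiv.Perm (Fin N)) (i : ℕ) : Prop :=
  ∀ p q : Fin N, (p : ℕ) < i → i ≤ q → σ p < σ q

theorem exists_pos_isSplitAt {N : ℕ} (σ : Equiv.Perm (Fin N)) : ∃ i, 0 < i ∧ IsSplitAt σ i :=
  -- The cut at N + 1 is vacuous and positive even for N = 0, so the empty permutation never counts
  -- as indecomposable.
  ⟨N + 1, N.succ_pos, fun _ q _ hq => by have := q.2; omega⟩

open Classical in
/-- The length of the first component of a permutation with respect to direct sums. -/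
def firstSplit {N : ℕ} (σ : Equiv.Perm (Fin N)) : ℕ := Nat.find (exists_pos_isSplitAt σ)

theorem firstSplit_pos {N : ℕ} (σ : Equiv.Perm (Fin N)) : 0 < firstSplit σ := by
  classical exact (Nat.find_spec (exists_pos_isSplitAt σ)).1

theorem isSplitAt_firstSplit {N : ℕ} (σ : Equiv.Perm (Fin N)) : IsSplitAt σ (firstSplit σ) := by
  classical exact (Nat.find_spec (exists_pos_isSplitAt σ)).2

theorem firstSplit_le {N : ℕ} {σ : Equiv.Perm (Fin N)} {i : ℕ} (hi : 0 < i)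
    (h : IsSplitAt σ i) : firstSplit σ ≤ i := by
  classical exact Nat.find_min' (exists_pos_isSplitAt σ) ⟨hi, h⟩

theorem firstSplit_le_size {N : ℕ} (hN : 0 < N) (σ : Equiv.Perm (Fin N)) : firstSplit σ ≤ N :=
  firstSplit_le hN fun _ q _ hq => by have := q.2; omega

/-- The complement of a permutation, which reverses the order of the values. -/
def complPerm {N : ℕ} (σ : Equiv.Perm (Fin N)) : Equiv.Perm (Fin N) := σ.trans Fin.revPerm

theorem complPerm_lt_iff {N : ℕ} (σ : Equiv.Perm (Fin N)) (p q : Fin N) :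
    complPerm σ p < complPerm σ q ↔ σ q < σ p := by
  simp [complPerm]

theorem complPerm_complPerm {N : ℕ} (σ : Equiv.Perm (Fin N)) : complPerm (complPerm σ) = σ := by
  ext p
  simp [complPerm]

theorem isSeparablePerm_complPerm {N : ℕ} (σ : Equiv.Perm (Fin N)) :
    IsSeparablePerm (complPerm σ) ↔ IsSeparablePerm σ := by
  simp only [isSeparablePerm_iff, complPerm_lt_iff]
  refine forall_congr' fun a => forall_congr' fun b => forall_congr' fun c => forall_congr' fun d =>
    forall_congr' fun _ => forall_congr' fun _ => forall_congr' fun _ => ?_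
  tauto

/-- A separable permutation of at least two letters is a direct sum or a skew sum. -/
theorem firstSplit_complPerm_eq_iff {N : ℕ} (hN : 2 ≤ N) (σ : Equiv.Perm (Fin N))
    (hσ : IsSeparablePerm σ) : firstSplit (complPerm σ) = N ↔ ¬ firstSplit σ = N := by
  constructor
  · intro h1 h2
    rw [isSeparablePerm_iff] at hσ
    -- The identity beyond N keeps f injective, since the values of σ are below N.
    let f : ℕ → ℤ := fun n => if h : n < N then ((σ ⟨n, h⟩ : ℕ) : ℤ) else n
    have hfv : ∀ p : Fin N, f p = ((σ p : ℕ) : ℤ) := fun p => by simp [f]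
    have hf : Function.Injective f := by
      intro a b hab
      by_cases ha : a < N <;> by_cases hb : b < N
      · have := (hfv ⟨a, ha⟩).symm.trans (hab.trans (hfv ⟨b, hb⟩))
        have := σ.injective (Fin.ext (by exact_mod_cast this))
        simpa using this
      · have := (hfv ⟨a, ha⟩).symm.trans hab
        simp only [f, hb, dite_false] at this
        have := (σ ⟨a, ha⟩).2
        omega
      · have := hab.trans (hfv ⟨b, hb⟩)
        simp only [f, ha, dite_false] at this
        have := (σ ⟨b, hb⟩).2
        omega
      · simpa [f, ha, hb] using hab
    have hlt : ∀ p q : Fin N, f p < f q ↔ σ p < σ q := fun p q => by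
      rw [hfv, hfv, Fin.lt_def]; exact Nat.cast_lt
    obtain ⟨i, hi, hiN, h | h⟩ := exists_split_of_avoids f hf N hN
      (fun a b c d hab hbc hcd hd => by
        have := hσ ⟨a, by omega⟩ ⟨b, by omega⟩ ⟨c, by omega⟩ ⟨d, hd⟩ hab hbc hcd
        simpa only [← hlt] using this)
    · have := firstSplit_le (σ := σ) hi fun p q hp hq => (hlt p q).1 (h p q hp hq q.2)
      omega
    · have := firstSplit_le (σ := complPerm σ) hi fun p q hp hq =>
        (complPerm_lt_iff σ p q).2 ((hlt q p).1 (h p q hp hq q.2))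
      omega
  · intro h1
    by_contra h2
    -- If both cuts were proper, the first and last positions would be compared in opposite ways.
    have hs := isSplitAt_firstSplit σ ⟨0, by omega⟩ ⟨N - 1, by omega⟩ (firstSplit_pos σ)
      (by have := firstSplit_le_size (by omega) σ; simp only; omega)
    have hc := isSplitAt_firstSplit (complPerm σ) ⟨0, by omega⟩ ⟨N - 1, by omega⟩
      (firstSplit_pos _)
      (by have := firstSplit_le_size (by omega) (complPerm σ); simp only; omega)
    rw [complPerm_lt_iff] at hc
    exact lt_asymm hs hc

/-! ### Direct sums -/

/-- The direct sum of two permutations. -/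
def sumPerm {i j : ℕ} (a : Equiv.Perm (Fin i)) (b : Equiv.Perm (Fin j)) :
    Equiv.Perm (Fin (i + j)) :=
  finSumFinEquiv.permCongr (Equiv.Perm.sumCongr a b)

section sumPerm

variable {i j : ℕ} (a : Equiv.Perm (Fin i)) (b : Equiv.Perm (Fin j))

@[simp] theorem sumPerm_castAdd (p : Fin i) :
    sumPerm a b (Fin.castAdd j p) = Fin.castAdd j (a p) := by
  simp [sumPerm, Equiv.permCongr_apply]

@[simp] theorem sumPerm_natAdd (p : Fin j) :
    sumPerm a b (Fin.natAdd i p) = Fin.natAdd i (b p) := by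
  simp [sumPerm, Equiv.permCongr_apply]

theorem castAdd_lt_castAdd {p q : Fin i} : Fin.castAdd j p < Fin.castAdd j q ↔ p < q := Iff.rfl

theorem isSplitAt_sumPerm_self : IsSplitAt (sumPerm a b) i := by
  intro p q hp hq
  induction p using Fin.addCases with
  | right p => simp at hp
  | left p =>
    induction q using Fin.addCases with
    | left q => have := q.2; simp at hq; omega
    | right q =>
      rw [sumPerm_castAdd, sumPerm_natAdd]
      exact Fin.lt_def.2 (by simp; omega)

theorem isSplitAt_sumPerm_iff {k : ℕ} (hk : k ≤ i) :
    IsSplitAt (sumPerm a b) k ↔ IsSplitAt a k := by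
  constructor
  · intro h p q hp hq
    simpa only [sumPerm_castAdd, castAdd_lt_castAdd] using
      h (Fin.castAdd j p) (Fin.castAdd j q) hp hq
  · intro h p q hp hq
    by_cases hqi : (q : ℕ) < i
    · have := h ⟨p, by omega⟩ ⟨q, hqi⟩ hp hq
      have hp' := sumPerm_castAdd a b ⟨p, by omega⟩
      have hq' := sumPerm_castAdd a b ⟨q, hqi⟩
      simp only [Fin.castAdd_mk, Fin.eta] at hp' hq'
      rw [hp', hq']
      exact this
    · exact isSplitAt_sumPerm_self a b p q (by omega) (by omega)

theorem firstSplit_sumPerm_eq_iff : firstSplit (sumPerm a b) = i ↔ firstSplit a = i := by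
  rcases Nat.eq_zero_or_pos i with rfl | hi
  · exact iff_of_false (firstSplit_pos _).ne' (firstSplit_pos _).ne'
  have h1 := firstSplit_le hi (isSplitAt_sumPerm_self a b)
  have h2 := firstSplit_le_size hi a
  have h3 := firstSplit_le (firstSplit_pos _)
    ((isSplitAt_sumPerm_iff a b h1).1 (isSplitAt_firstSplit _))
  have h4 := firstSplit_le (firstSplit_pos _)
    ((isSplitAt_sumPerm_iff a b h2).2 (isSplitAt_firstSplit _))
  omega

/-- Neither 2413 nor 3142 has a proper prefix lying below the rest, so no occurrence can straddle
the junction. The cases below locate the junction within the four positions. -/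
theorem isSeparablePerm_sumPerm_iff :
    IsSeparablePerm (sumPerm a b) ↔ IsSeparablePerm a ∧ IsSeparablePerm b := by
  simp only [isSeparablePerm_iff]
  constructor
  · intro h
    constructor
    · intro p q r s hpq hqr hrs
      simpa only [sumPerm_castAdd, castAdd_lt_castAdd] using
        h (Fin.castAdd j p) (Fin.castAdd j q) (Fin.castAdd j r) (Fin.castAdd j s) hpq hqr hrs
    · intro p q r s hpq hqr hrs
      simpa using h (Fin.natAdd i p) (Fin.natAdd i q) (Fin.natAdd i r) (Fin.natAdd i s)
        (by simpa) (by simpa) (by simpa)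
  · rintro ⟨ha, hb⟩ p q r s hpq hqr hrs
    have hsplit := isSplitAt_sumPerm_self a b
    by_cases hs : (s : ℕ) < i
    · have key : ∀ t : Fin (i + j), (t : ℕ) < i → ∃ u : Fin i, t = Fin.castAdd j u :=
        fun t ht => ⟨⟨t, ht⟩, rfl⟩
      obtain ⟨p, rfl⟩ := key p (by omega)
      obtain ⟨q, rfl⟩ := key q (by omega)
      obtain ⟨r, rfl⟩ := key r (by omega)
      obtain ⟨s, rfl⟩ := key s hs
      simpa only [sumPerm_castAdd, castAdd_lt_castAdd] using ha p q r s hpq hqr hrs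
    by_cases hp : i ≤ (p : ℕ)
    · have key : ∀ t : Fin (i + j), i ≤ (t : ℕ) → ∃ u : Fin j, t = Fin.natAdd i u := fun t ht =>
        ⟨⟨t - i, by omega⟩, Fin.ext (by simp; omega)⟩
      obtain ⟨p, rfl⟩ := key p hp
      obtain ⟨q, rfl⟩ := key q (by omega)
      obtain ⟨r, rfl⟩ := key r (by omega)
      obtain ⟨s, rfl⟩ := key s (by omega)
      simpa using hb p q r s (by simpa using hpq) (by simpa using hqr) (by simpa using hrs)
    by_cases hq : i ≤ (q : ℕ)
    · have h1 := hsplit p r (by omega) (by omega)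
      have h2 := hsplit p s (by omega) (by omega)
      exact ⟨fun h => by order, fun h => by order⟩
    by_cases hr : i ≤ (r : ℕ)
    · have h1 := hsplit q r (by omega) hr
      have h2 := hsplit q s (by omega) (by omega)
      have h3 := hsplit p s (by omega) (by omega)
      exact ⟨fun h => by order, fun h => by order⟩
    · have h1 := hsplit q s (by omega) (by omega)
      have h2 := hsplit p s (by omega) (by omega)
      exact ⟨fun h => by order, fun h => by order⟩

end sumPerm

theorem sumPerm_inj {i j : ℕ} {a a' : Equiv.Perm (Fin i)} {b b' : Equiv.Perm (Fin j)} :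
    sumPerm a b = sumPerm a' b' ↔ a = a' ∧ b = b' := by
  constructor
  · intro h
    refine ⟨Equiv.ext fun p => ?_, Equiv.ext fun p => ?_⟩
    · have := congrArg (· (Fin.castAdd j p)) h
      simpa using this
    · have := congrArg (· (Fin.natAdd i p)) h
      simpa using this
  · rintro ⟨rfl, rfl⟩
    rfl

/-- A permutation which splits at `i` maps the first `i` positions to the first `i` values. -/
theorem IsSplitAt.apply_lt {N i : ℕ} {σ : Equiv.Perm (Fin N)} (h : IsSplitAt σ i) {p : Fin N}
    (hp : (p : ℕ) < i) : (σ p : ℕ) < i := by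
  by_contra hlt
  -- All `σ p + 1` values up to `σ p` are taken on the first i positions; counting gives the
  -- contradiction.
  have hsub : (Finset.Iic (σ p)).map σ.symm.toEmbedding ⊆
      Finset.univ.filter (fun q : Fin N => (q : ℕ) < i) := by
    intro q hq
    simp only [Finset.mem_map_equiv, Equiv.symm_symm, Finset.mem_Iic] at hq
    simp only [Finset.mem_filter, Finset.mem_univ, true_and]
    by_contra hqi
    exact absurd (h p q hp (by omega)) (not_lt.2 hq)
  have hcard := Finset.card_le_card hsub
  have : (Finset.univ.filter (fun q : Fin N => (q : ℕ) < i)).card ≤ i := by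
    have := Finset.card_le_card_of_injOn (s := Finset.univ.filter (fun q : Fin N => (q : ℕ) < i))
      (t := Finset.range i) (fun q => (q : ℕ)) (fun q hq => by simpa using hq)
      (fun q _ r _ h => Fin.ext h)
    simpa using this
  rw [Finset.card_map, Fin.card_Iic] at hcard
  omega

theorem IsSplitAt.exists_eq_sumPerm {i j : ℕ} {σ : Equiv.Perm (Fin (i + j))}
    (h : IsSplitAt σ i) : ∃ a b, σ = sumPerm a b := by
  have hmaps : Set.MapsTo (finSumFinEquiv.symm.permCongr σ)
      (Set.range (Sum.inl : Fin i → Fin i ⊕ Fin j)) (Set.range Sum.inl) := by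
    rintro _ ⟨p, rfl⟩
    have hlt : (σ (Fin.castAdd j p) : ℕ) < i := h.apply_lt (by simp)
    refine ⟨⟨_, hlt⟩, ?_⟩
    rw [Equiv.permCongr_apply, Equiv.eq_symm_apply]
    simp
  obtain ⟨⟨a, b⟩, hab⟩ := Equiv.Perm.mem_sumCongrHom_range_of_perm_mapsTo_inl hmaps
  refine ⟨a, b, ?_⟩
  have hab' : Equiv.Perm.sumCongr a b = finSumFinEquiv.symm.permCongr σ := hab
  rw [sumPerm, hab']
  ext x
  simp [Equiv.permCongr_apply]

/-! ### Descents of sums and complements -/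

open Classical in
theorem descentCount_eq_sum {N : ℕ} (σ : Equiv.Perm (Fin N)) :
    descentCount σ =
      ∑ p : Fin N, if ∃ h : (p : ℕ) + 1 < N, σ ⟨(p : ℕ) + 1, h⟩ < σ p then 1 else 0 := by
  rw [descentCount, Nat.card_eq_fintype_card, Fintype.card_subtype, Finset.card_filter]

theorem descentCount_sumPerm {i j : ℕ} (a : Equiv.Perm (Fin i)) (b : Equiv.Perm (Fin j)) :
    descentCount (sumPerm a b) = descentCount a + descentCount b := by
  classical
  simp only [descentCount_eq_sum]
  rw [Fin.sum_univ_add]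
  congr 1
  · refine Finset.sum_congr rfl fun p _ => if_congr ?_ rfl rfl
    constructor
    · rintro ⟨h, hlt⟩
      by_cases hp : (p : ℕ) + 1 < i
      · refine ⟨hp, ?_⟩
        rw [sumPerm_castAdd] at hlt
        have := sumPerm_castAdd a b ⟨p + 1, hp⟩
        rw [show (⟨((Fin.castAdd j p : Fin (i + j)) : ℕ) + 1, h⟩ : Fin (i + j)) =
          Fin.castAdd j ⟨p + 1, hp⟩ from rfl, this] at hlt
        exact hlt
      · exact absurd hlt (lt_asymm (isSplitAt_sumPerm_self a b _ _ (by simp)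
          (by simpa using not_lt.1 hp)))
    · rintro ⟨h, hlt⟩
      refine ⟨by simp; omega, ?_⟩
      rw [show (⟨((Fin.castAdd j p : Fin (i + j)) : ℕ) + 1, by simp; omega⟩ : Fin (i + j)) =
          Fin.castAdd j ⟨p + 1, h⟩ from rfl, sumPerm_castAdd, sumPerm_castAdd]
      exact hlt
  · refine Finset.sum_congr rfl fun p _ => if_congr ?_ rfl rfl
    constructor
    · rintro ⟨h, hlt⟩
      have hp : (p : ℕ) + 1 < j := by simp at h; omega
      refine ⟨hp, ?_⟩
      rw [show (⟨((Fin.natAdd i p : Fin (i + j)) : ℕ) + 1, h⟩ : Fin (i + j)) =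
          Fin.natAdd i ⟨p + 1, hp⟩ from rfl, sumPerm_natAdd, sumPerm_natAdd] at hlt
      simpa using hlt
    · rintro ⟨h, hlt⟩
      refine ⟨by simp; omega, ?_⟩
      rw [show (⟨((Fin.natAdd i p : Fin (i + j)) : ℕ) + 1, by simp; omega⟩ : Fin (i + j)) =
          Fin.natAdd i ⟨p + 1, h⟩ from rfl, sumPerm_natAdd, sumPerm_natAdd]
      simpa using hlt

/-- Each of the n adjacent pairs is a descent of exactly one of the two permutations. -/
theorem descentCount_add_descentCount_complPerm {n : ℕ} (σ : Equiv.Perm (Fin (n + 1))) :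
    descentCount σ + descentCount (complPerm σ) = n := by
  classical
  simp only [descentCount_eq_sum, complPerm_lt_iff]
  rw [← Finset.sum_add_distrib, Fin.sum_univ_castSucc]
  have hterm : ∀ p : Fin n,
      ((if ∃ h : ((p.castSucc : Fin (n + 1)) : ℕ) + 1 < n + 1,
        σ ⟨(p.castSucc : ℕ) + 1, h⟩ < σ p.castSucc then 1 else 0) +
      (if ∃ h : ((p.castSucc : Fin (n + 1)) : ℕ) + 1 < n + 1,
        σ p.castSucc < σ ⟨(p.castSucc : ℕ) + 1, h⟩ then 1 else 0)) = 1 := by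
    intro p
    have hp : ((p.castSucc : Fin (n + 1)) : ℕ) + 1 < n + 1 := by simp
    simp only [hp, exists_true_left]
    have hne : σ p.castSucc ≠ σ ⟨(p.castSucc : ℕ) + 1, hp⟩ :=
      σ.injective.ne fun h => by have := congrArg Fin.val h; simp at this
    rcases lt_or_gt_of_ne hne with h | h
    · rw [if_neg h.not_gt, if_pos h]
    · rw [if_pos h, if_neg h.not_gt]
  rw [Finset.sum_congr rfl fun p _ => hterm p]
  simp

/-! ### Descent polynomials and their recurrences -/

open Classical in
/-- The separable permutations of `N` letters. -/
def sepPerms (N : ℕ) : Finset (Equiv.Perm (Fin N)) :=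
  Finset.univ.filter IsSeparablePerm

@[simp] theorem mem_sepPerms {N : ℕ} {σ : Equiv.Perm (Fin N)} :
    σ ∈ sepPerms N ↔ IsSeparablePerm σ := by
  simp [sepPerms]

theorem sepPerms_zero : sepPerms 0 = Finset.univ := by
  ext σ
  simp only [mem_sepPerms, Finset.mem_univ, iff_true, isSeparablePerm_iff]
  exact fun a => a.elim0

theorem sepPerms_one : sepPerms 1 = Finset.univ := by
  ext σ
  simp only [mem_sepPerms, Finset.mem_univ, iff_true, isSeparablePerm_iff]
  exact fun a b c d hab => absurd hab (by simp [Subsingleton.elim a b])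

section Decomposition

variable {R : Type*} [CommSemiring R]

/-- Separable permutations with first component of length `i` are the direct sums of an
indecomposable separable permutation of `i` letters and a separable permutation. -/
theorem sum_filter_firstSplit_eq (i j : ℕ) (F : Equiv.Perm (Fin (i + j)) → R) :
    ∑ σ ∈ sepPerms (i + j) with firstSplit σ = i, F σ =
      ∑ a ∈ sepPerms i with firstSplit a = i, ∑ b ∈ sepPerms j, F (sumPerm a b) := by
  rw [← Finset.sum_product']
  symm
  refine Finset.sum_bij (fun ab _ => sumPerm ab.1 ab.2) ?_ ?_ ?_ fun _ _ => rfl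
  · rintro ⟨a, b⟩ h
    simp only [Finset.mem_product, Finset.mem_filter, mem_sepPerms] at h ⊢
    exact ⟨(isSeparablePerm_sumPerm_iff a b).2 ⟨h.1.1, h.2⟩,
      (firstSplit_sumPerm_eq_iff a b).2 h.1.2⟩
  · rintro ⟨a, b⟩ _ ⟨a', b'⟩ _ h
    exact Prod.ext_iff.2 (sumPerm_inj.1 h)
  · intro σ h
    simp only [Finset.mem_filter, mem_sepPerms] at h
    have hs := isSplitAt_firstSplit σ
    rw [h.2] at hs
    obtain ⟨a, b, rfl⟩ := hs.exists_eq_sumPerm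
    have hab := (isSeparablePerm_sumPerm_iff a b).1 h.1
    refine ⟨(a, b), ?_, rfl⟩
    simp only [Finset.mem_product, Finset.mem_filter, mem_sepPerms]
    exact ⟨⟨hab.1, (firstSplit_sumPerm_eq_iff a b).1 h.2⟩, hab.2⟩

theorem sum_sepPerms_eq_sum_firstSplit {N : ℕ} (hN : 0 < N) (F : Equiv.Perm (Fin N) → R) :
    ∑ σ ∈ sepPerms N, F σ =
      ∑ ij ∈ Finset.HasAntidiagonal.antidiagonal N, ∑ σ ∈ sepPerms N with firstSplit σ = ij.1, F σ := by
  rw [Finset.Nat.sum_antidiagonal_eq_sum_range_succ_mk]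
  exact (Finset.sum_fiberwise_of_maps_to (fun σ _ => by
    have := firstSplit_le_size hN σ
    simp only [Finset.mem_range]
    omega) F).symm

theorem sum_sepPerms_complPerm (N : ℕ) (F : Equiv.Perm (Fin N) → R) :
    ∑ σ ∈ sepPerms N, F (complPerm σ) = ∑ σ ∈ sepPerms N, F σ :=
  Finset.sum_nbij' complPerm complPerm
    (fun σ h => mem_sepPerms.2 ((isSeparablePerm_complPerm σ).2 (mem_sepPerms.1 h)))
    (fun σ h => mem_sepPerms.2 ((isSeparablePerm_complPerm σ).2 (mem_sepPerms.1 h)))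
    (fun σ _ => complPerm_complPerm σ) (fun σ _ => complPerm_complPerm σ) fun _ _ => rfl

variable (y : R)

/-- The descent polynomial of the separable permutations of `N` letters. -/
def sepPoly (N : ℕ) : R := ∑ σ ∈ sepPerms N, y ^ descentCount σ

/-- The descent polynomial of the separable permutations which are not direct sums. -/
def sumIndecPoly (N : ℕ) : R := ∑ σ ∈ sepPerms N with firstSplit σ = N, y ^ descentCount σ

/-- The descent polynomial of the separable permutations which are not skew sums. -/
def skewIndecPoly (N : ℕ) : R :=
  ∑ σ ∈ sepPerms N with firstSplit σ = N, y ^ descentCount (complPerm σ)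

theorem sepPoly_eq_sum_antidiagonal {N : ℕ} (hN : 0 < N) :
    sepPoly y N = ∑ ij ∈ Finset.HasAntidiagonal.antidiagonal N, sumIndecPoly y ij.1 * sepPoly y ij.2 := by
  rw [sepPoly, sum_sepPerms_eq_sum_firstSplit hN]
  refine Finset.sum_congr rfl fun ⟨i, j⟩ hij => ?_
  obtain rfl := Finset.HasAntidiagonal.mem_antidiagonal.1 hij
  rw [sum_filter_firstSplit_eq, sumIndecPoly, sepPoly, Finset.sum_mul_sum]
  simp only [descentCount_sumPerm, pow_add]

theorem sumIndecPoly_zero : sumIndecPoly y 0 = 0 := by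
  rw [sumIndecPoly, Finset.filter_false_of_mem fun σ _ => (firstSplit_pos σ).ne', Finset.sum_empty]

theorem skewIndecPoly_zero : skewIndecPoly y 0 = 0 := by
  rw [skewIndecPoly, Finset.filter_false_of_mem fun σ _ => (firstSplit_pos σ).ne',
    Finset.sum_empty]

theorem descentCount_of_subsingleton {N : ℕ} (hN : N ≤ 1) (σ : Equiv.Perm (Fin N)) :
    descentCount σ = 0 := by
  have : IsEmpty {i : Fin N // ∃ h : (i : ℕ) + 1 < N, σ ⟨(i : ℕ) + 1, h⟩ < σ i} :=
    ⟨fun ⟨i, h, _⟩ => by omega⟩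
  rw [descentCount, Nat.card_of_isEmpty]

theorem sepPoly_zero : sepPoly y 0 = 1 := by
  simp [sepPoly, sepPerms_zero, descentCount_of_subsingleton]

theorem sepPoly_one : sepPoly y 1 = 1 := by
  simp [sepPoly, sepPerms_one, descentCount_of_subsingleton]

theorem firstSplit_of_size_one (σ : Equiv.Perm (Fin 1)) : firstSplit σ = 1 :=
  le_antisymm (firstSplit_le_size one_pos σ) (firstSplit_pos σ)

theorem sumIndecPoly_one : sumIndecPoly y 1 = 1 := by
  simp [sumIndecPoly, firstSplit_of_size_one, sepPerms_one, descentCount_of_subsingleton]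

theorem skewIndecPoly_one : skewIndecPoly y 1 = 1 := by
  simp [skewIndecPoly, firstSplit_of_size_one, sepPerms_one, descentCount_of_subsingleton]

/-- Complementation turns the second sum into one over the direct sums. A single letter would be
counted twice, hence `2 ≤ N`. -/
theorem sumIndecPoly_add_skewIndecPoly {N : ℕ} (hN : 2 ≤ N) :
    sumIndecPoly y N + skewIndecPoly y N = sepPoly y N := by
  have h : skewIndecPoly y N =
      ∑ σ ∈ sepPerms N with ¬ firstSplit σ = N, y ^ descentCount σ := by
    rw [skewIndecPoly, Finset.sum_filter, Finset.sum_filter, ← sum_sepPerms_complPerm]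
    refine Finset.sum_congr rfl fun σ hσ => ?_
    rw [complPerm_complPerm]
    exact if_congr (firstSplit_complPerm_eq_iff hN σ (mem_sepPerms.1 hσ)) rfl rfl
  rw [h, sumIndecPoly, sepPoly, Finset.sum_filter_add_sum_filter_not]

/-- The junction of the complement is the extra descent. Here it comes out of counting adjacent
pairs: the sum has one more than its two summands together. -/
theorem descentCount_complPerm_sumPerm {i j : ℕ} (a : Equiv.Perm (Fin (i + 1)))
    (b : Equiv.Perm (Fin (j + 1))) : descentCount (complPerm (sumPerm a b)) =
      descentCount (complPerm a) + descentCount (complPerm b) + 1 := by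
  have h := descentCount_add_descentCount_complPerm (n := i + 1 + j)
      (show Equiv.Perm (Fin (i + 1 + j + 1)) from sumPerm (j := j + 1) a b)
  change descentCount (sumPerm a b) + descentCount (complPerm (sumPerm a b)) = _ at h
  have ha := descentCount_add_descentCount_complPerm a
  have hb := descentCount_add_descentCount_complPerm b
  have hab := descentCount_sumPerm a b
  omega

theorem descentCount_complPerm_sumPerm_zero {i : ℕ} (a : Equiv.Perm (Fin i))
    (b : Equiv.Perm (Fin 0)) :
    descentCount (complPerm (sumPerm a b)) = descentCount (complPerm a) := by
  cases i with
  | zero => rw [descentCount_of_subsingleton (by simp), descentCount_of_subsingleton (by simp)]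
  | succ i =>
    have h := descentCount_add_descentCount_complPerm (n := i)
      (show Equiv.Perm (Fin (i + 1)) from sumPerm (j := 0) a b)
    change descentCount (sumPerm a b) + descentCount (complPerm (sumPerm a b)) = _ at h
    have ha := descentCount_add_descentCount_complPerm a
    have hab := descentCount_sumPerm a b
    rw [descentCount_of_subsingleton (by simp) b] at hab
    omega

/-- Complementing reduces skew sums to direct sums. The factor y is the junction descent, absent
when the second summand is empty. -/
theorem sepPoly_eq_sum_antidiagonal_skew {N : ℕ} (hN : 0 < N) :
    sepPoly y N = ∑ ij ∈ Finset.HasAntidiagonal.antidiagonal N,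
      skewIndecPoly y ij.1 * (if ij.2 = 0 then 1 else y * sepPoly y ij.2) := by
  rw [sepPoly, ← sum_sepPerms_complPerm, sum_sepPerms_eq_sum_firstSplit hN]
  refine Finset.sum_congr rfl fun ⟨i, j⟩ hij => ?_
  obtain rfl := Finset.HasAntidiagonal.mem_antidiagonal.1 hij
  dsimp only
  rw [sum_filter_firstSplit_eq]
  rcases i with _ | i
  · rw [skewIndecPoly_zero, zero_mul,
      Finset.filter_false_of_mem fun σ _ => (firstSplit_pos σ).ne', Finset.sum_empty]
  rcases j with _ | j
  · simp [skewIndecPoly, sepPerms_zero, descentCount_complPerm_sumPerm_zero]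
  · rw [if_neg j.succ_ne_zero, skewIndecPoly, sepPoly, ← sum_sepPerms_complPerm (j + 1),
      Finset.mul_sum, Finset.sum_mul_sum]
    refine Finset.sum_congr rfl fun a _ => Finset.sum_congr rfl fun b _ => ?_
    rw [descentCount_complPerm_sumPerm]
    ring

end Decomposition

/-! ### Functional equation and compositional inverse -/

section GeneratingFunction

open PowerSeries

variable {R : Type*} [CommRing R] (y : R)

/-- The generating function of the nonempty separable permutations. -/
def sepSeries : PowerSeries R := PowerSeries.mk (sepPoly y) - 1

theorem coeff_sepSeries (n : ℕ) :
    coeff n (sepSeries y) = if n = 0 then 0 else sepPoly y n := by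
  rw [sepSeries, map_sub, coeff_mk, coeff_one]
  split_ifs with h
  · rw [h, sepPoly_zero, sub_self]
  · rw [sub_zero]

theorem constantCoeff_sepSeries : constantCoeff (sepSeries y) = 0 := by
  rw [← coeff_zero_eq_constantCoeff_apply, coeff_sepSeries, if_pos rfl]

theorem sepSeries_eq_sum_decomposition :
    sepSeries y = PowerSeries.mk (sumIndecPoly y) * (1 + sepSeries y) := by
  ext n
  rw [coeff_sepSeries, sepSeries, add_sub_cancel, coeff_mul]
  split_ifs with hn
  · subst hn
    simp [sumIndecPoly_zero]
  · rw [sepPoly_eq_sum_antidiagonal y (Nat.pos_of_ne_zero hn)]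
    simp only [coeff_mk]

theorem sepSeries_eq_skew_decomposition :
    sepSeries y = PowerSeries.mk (skewIndecPoly y) * (1 + C y * sepSeries y) := by
  ext n
  rw [coeff_sepSeries, coeff_mul]
  split_ifs with hn
  · subst hn
    simp [skewIndecPoly_zero]
  · rw [sepPoly_eq_sum_antidiagonal_skew y (Nat.pos_of_ne_zero hn)]
    refine Finset.sum_congr rfl fun ij _ => ?_
    rw [coeff_mk, map_add, coeff_C_mul, coeff_sepSeries, coeff_one]
    split_ifs <;> simp

theorem mk_sumIndecPoly_add_mk_skewIndecPoly :
    PowerSeries.mk (sumIndecPoly y) + PowerSeries.mk (skewIndecPoly y) = sepSeries y + X := by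
  ext n
  rw [map_add, map_add, coeff_mk, coeff_mk, coeff_sepSeries, coeff_X]
  rcases n with _ | _ | n
  · simp [sumIndecPoly_zero, skewIndecPoly_zero]
  · simp [sumIndecPoly_one, skewIndecPoly_one, sepPoly_one]
  · simp [sumIndecPoly_add_skewIndecPoly y (N := n + 1 + 1) (by omega)]

theorem sepSeries_functional_equation :
    sepSeries y * (1 - sepSeries y ^ 2 * C y) =
      X * ((1 + sepSeries y) * (1 + sepSeries y * C y)) := by
  have h1 := sepSeries_eq_sum_decomposition y
  have h2 := sepSeries_eq_skew_decomposition y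
  have h3 := mk_sumIndecPoly_add_mk_skewIndecPoly y
  linear_combination (1 + C y * sepSeries y) * h1 + (1 + sepSeries y) * h2 +
    (1 + sepSeries y) * (1 + C y * sepSeries y) * h3

theorem subst_algebraic {G : PowerSeries R} (hG : HasSubst G) (q : R) :
    subst G (cSeries y q) * ((1 + G * C q) * (1 + G * C y * C q)) =
      G * (1 - C (q ^ 2) * G ^ 2 * C y) := by
  have h := congrArg (substAlgHom hG) (cSeries_mul_denominator y q)
  have hX : substAlgHom hG (X : PowerSeries R) = G := substAlgHom_X hG
  have hC : ∀ r : R, substAlgHom hG (C r : PowerSeries R) = C r := fun r =>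
    (substAlgHom hG).commutes r
  simp only [map_mul, map_add, map_sub, map_one, map_pow, hX, hC] at h
  rw [coe_substAlgHom] at h
  rw [h, map_pow]

/-- The compositional inverse of `cSeries y q` is the only solution of its algebraic equation. -/
theorem eq_cSeriesInv {G : PowerSeries R} (q : R) (hG : constantCoeff G = 0)
    (h : G * (1 - C (q ^ 2) * G ^ 2 * C y) = X * ((1 + G * C q) * (1 + G * C y * C q))) :
    G = cSeriesInv y q := by
  have hs : HasSubst G := HasSubst.of_constantCoeff_zero' hG
  -- Substituting G keeps the denominator invertible, so it cancels and G is inverse to `cSeries y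
  -- q` on one side; the other inverse law then identifies G.
  have hu : IsUnit ((1 + G * C q) * (1 + G * C y * C q)) := by
    rw [isUnit_iff_constantCoeff]
    simp [hG]
  have hX : subst G (cSeries y q) = X :=
    hu.mul_right_cancel ((subst_algebraic y hs q).trans h)
  calc G = subst G (X : PowerSeries R) := (subst_X hs).symm
    _ = subst G (subst (cSeries y q) (cSeriesInv y q)) := by rw [(cSeriesInv_spec y q).2]
    _ = subst (subst G (cSeries y q)) (cSeriesInv y q) :=
      subst_comp_subst_apply (HasSubst.of_constantCoeff_zero' (constantCoeff_cSeries y q)) hs _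
    _ = cSeriesInv y q := by rw [hX, X_subst]

theorem constantCoeff_cSeriesInv (q : R) : constantCoeff (cSeriesInv y q) = 0 :=
  constantCoeff_substInvOfIsUnit _ _

/-- The image solves the image of the algebraic equation, whose solution is unique. This permits
setting q = 1 inside `pTree`. -/
theorem map_cSeriesInv {S : Type*} [CommRing S] (f : R →+* S) (q : R) :
    PowerSeries.map f (cSeriesInv y q) = cSeriesInv (f y) (f q) := by
  have hG := constantCoeff_cSeriesInv y q
  refine eq_cSeriesInv _ _ ?_ ?_
  · rw [← coeff_zero_eq_constantCoeff_apply, coeff_map, coeff_zero_eq_constantCoeff_apply, hG,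
      map_zero]
  · have h := subst_algebraic y (HasSubst.of_constantCoeff_zero' hG) q
    rw [(cSeriesInv_spec y q).1] at h
    simpa only [map_mul, map_add, map_sub, map_one, map_pow, map_X, map_C]
      using congrArg (PowerSeries.map f) h.symm

theorem cSeriesInv_one : cSeriesInv y 1 = sepSeries y := by
  refine (eq_cSeriesInv y 1 (constantCoeff_sepSeries y) ?_).symm
  simpa using sepSeries_functional_equation y

theorem substInvOfIsUnit_congr {P Q : PowerSeries R} (h : P = Q) (hP : IsUnit (coeff 1 P))
    (hQ : IsUnit (coeff 1 Q)) : substInvOfIsUnit P hP = substInvOfIsUnit Q hQ := by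
  subst h
  rfl

theorem sepC_eq_cSeries : sepC = cSeries (Polynomial.X : Polynomial ℤ) 1 := by
  simp [sepC, cSeries]

theorem sepCInv_eq_sepSeries : sepCInv = sepSeries (Polynomial.X : Polynomial ℤ) := by
  rw [← cSeriesInv_one]
  exact substInvOfIsUnit_congr sepC_eq_cSeries _ _

theorem pTreeAtOne_eq :
    pTreeAtOne = X + X * C Polynomial.X + X * C Polynomial.X * sepCInv := by
  rw [pTreeAtOne, pTree, sepCInv_eq_sepSeries, ← cSeriesInv_one]
  simp only [map_mul, map_add, map_one, map_X, map_C, map_cSeriesInv]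
  simp
  ring

end GeneratingFunction

theorem coeff_sepPoly_X (N k : ℕ) :
    (sepPoly (Polynomial.X : Polynomial ℤ) N).coeff k =
      Nat.card {σ : Equiv.Perm (Fin N) // IsSeparablePerm σ ∧ descentCount σ = k} := by
  classical
  rw [Nat.card_eq_fintype_card, Fintype.card_subtype, sepPoly, Polynomial.finsetSum_coeff]
  simp only [Polynomial.coeff_X_pow]
  rw [Finset.sum_boole, sepPerms, Finset.filter_filter]
  simp only [eq_comm]

end

theorem mainTheorem6 (n k : ℕ) (hn : 1 ≤ n) (hnk : (n, k) ≠ (1, 0)) :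
    (Nat.card {σ : Equiv.Perm (Fin (n - 1)) // IsSeparablePerm σ ∧ descentCount σ + 1 = k} : ℤ) =
        coeffXY n k pTreeAtOne ∧
      coeffXY n k pTreeAtOne =
        coeffXY n k
          (PowerSeries.X + PowerSeries.X * PowerSeries.C Polynomial.X +
            PowerSeries.X * PowerSeries.C Polynomial.X * sepCInv) := by
  refine ⟨?_, by rw [pTreeAtOne_eq]⟩
  obtain ⟨m, rfl⟩ : ∃ m, n = m + 1 := ⟨n - 1, by omega⟩
  -- The term xy supplies the empty permutation. The outer x and the inner y account for the shifts
  -- to n - 1 letters and k - 1 descents; the leftover x is the excluded case (1, 0).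
  have hP : pTreeAtOne = PowerSeries.X *
      (1 + PowerSeries.C Polynomial.X * PowerSeries.mk (sepPoly Polynomial.X)) := by
    rw [pTreeAtOne_eq, sepCInv_eq_sepSeries, sepSeries]
    ring
  rw [coeffXY, hP, PowerSeries.coeff_succ_X_mul, map_add, PowerSeries.coeff_C_mul,
    PowerSeries.coeff_mk, PowerSeries.coeff_one, Polynomial.coeff_add, Nat.add_sub_cancel]
  rcases k with _ | k
  · have hm : m ≠ 0 := by rintro rfl; exact hnk rfl
    have : IsEmpty {σ : Equiv.Perm (Fin m) // IsSeparablePerm σ ∧ descentCount σ + 1 = 0} :=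
      ⟨fun ⟨_, _, h⟩ => Nat.succ_ne_zero _ h⟩
    simp [hm]
  · rw [Polynomial.coeff_X_mul, coeff_sepPoly_X]
    have h0 : (if m = 0 then (1 : Polynomial ℤ) else 0).coeff (k + 1) = 0 := by
      split_ifs <;> simp [Polynomial.coeff_one]
    rw [h0, zero_add]
    simp only [Nat.add_right_cancel_iff]
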